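/- Let $\mathbb{N}^*=\{0,0^*,1,1^*,2,2^*,\dots\}$ be ordered by $0\prec 0^*\prec 1\prec 1^*\prec\cdots$; for $x\in\mathbb{N}$ let $|x|=|x^*|=x$, and for $k \in \mathbb{N}$ let $[k]=\{0,0^*,\dots,k,k^*\}$. The mark $*$ denotes the tie-breaking advantage. For $x,y\in\mathbb{N}$ put $x\oplus y=x+y$, $x^*\oplus y=x\oplus y^*=(x+y)^*$, $x\ominus y=x-y$, $x^*\ominus y=(x-y)^*$, $x^*\ominus y^*=x-y$. An energy bidding game $\mathcal{G}=\langle V,E,k,w\rangle$ consists of a finite directed graph $\langle V,E\rangle$ in which every vertex $v$ has a non-empty set $N(v)=\{u:(v,u)\in E\}$ of neighbours, a total budget $k\in\mathbb{N}$, and a weight function $w:E\to\mathbb{Z}$. A configuration $\langle v,B\rangle\in V\times[k]$ means that the token is at $v$, that player Pres has budget $B$, and that player Cons has budget $k^*\ominus B$. In each turn the players simultaneously choose actions $\langle b_1,v_1\rangle$ (Pres) and $\langle b_2,v_2\rangle$ (Cons), where $v_1,v_2\in N(v)$, each bid is at most the bidder's budget, and a bid may carry $*$ only if the bidder's budget does.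 If $b_1\succ b_2$, or if $b_1=b_2$ and $B\in\mathbb{N}$, the next configuration is $\langle v_1,B\ominus b_1\rangle$; otherwise it is $\langle v_2,B\oplus b_2\rangle$. Strategies are deterministic functions from finite histories of configurations to allowed actions. For an initial energy $M\in\mathbb{Z}$, Pres $M$-wins an infinite path $v_0,v_1,\dots$ if $M+\sum_{j<m}w(v_j,v_{j+1})\ge 0$ for every $m\in\mathbb{N}$, and otherwise Cons $M$-wins it. A player $M$-wins from a configuration if the player has a strategy such that, against every strategy of the opponent, the player $M$-wins the resulting path. An energy threshold is a function $\mathrm{en}:V\times[k]\to\mathbb{N}\cup\{\infty\}$ such that, for every configuration $\langle v,B\rangle$: if $\mathrm{en}(v,B)=M\in\mathbb{N}$, then Pres $M$-wins and Cons $(M-1)$-wins from $\langle v,B\rangle$; if $\mathrm{en}(v,B)=\infty$, then Cons $M$-wins from $\langle v,B\rangle$ for every $M\in\mathbb{N}$. The threshold budget $\mathrm{Th}:V\to[k]\cup\{k+1\}$ assigns to $v$ the least $B\in[k]$ with $\mathrm{en}(v,B)<\infty$, and $k+1$ if there is no such $B$. Theorem. In every energy bidding game there is exactly one energy threshold $\mathrm{en}$,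 so that $\mathrm{Th}$ is well defined, and $\mathrm{Th}$ satisfies the average property: for every $v\in V$, if $v^+$ and $v^-$ are neighbours of $v$ at which $\mathrm{Th}$ is maximal and minimal, respectively, among the neighbours of $v$, then $$\mathrm{Th}(v)=\left\lfloor\frac{|\mathrm{Th}(v^+)|+|\mathrm{Th}(v^-)|}{2}\right\rfloor+\varepsilon,$$ where $\varepsilon=0$ if $|\mathrm{Th}(v^+)|+|\mathrm{Th}(v^-)|$ is even and $\mathrm{Th}(v^-)\in\mathbb{N}$; $\varepsilon=1$ if this sum is odd and $\mathrm{Th}(v^-)\in\mathbb{N}^*\setminus\mathbb{N}$; and $\varepsilon=*$ otherwise (for $m\in\mathbb{N}$, $m+*$ means $m^*$). -/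

import Mathlib

/-- The set `ℕ* = {0, 0*, 1, 1*, …}` of budgets and bids: a natural number together with a flag
saying whether the tie-breaking advantage `*` is held (for a budget) or used (for a bid). -/
structure StarNat where
  /-- The integral part `|B|`. -/
  int : ℕ
  /-- The advantage flag: `⟨x, true⟩` is `x*` and `⟨x, false⟩` is `x`. -/
  adv : Bool

namespace StarNat

/-- The position of an element in the order `0 ≺ 0* ≺ 1 ≺ 1* ≺ …`. -/
def code (B : StarNat) : ℕ := 2 * B.int + B.adv.toNat

theorem code_injective : Function.Injective code := by
  rintro ⟨x, a⟩ ⟨y, b⟩ h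
  cases a <;> cases b <;> simp [code] at h ⊢ <;> omega

/-- The order `0 ≺ 0* ≺ 1 ≺ 1* ≺ …`. -/
noncomputable instance : LinearOrder StarNat := LinearOrder.lift' code code_injective

theorem le_iff_code (A B : StarNat) : A ≤ B ↔ A.code ≤ B.code := Iff.rfl

theorem lt_iff_code (A B : StarNat) : A < B ↔ A.code < B.code := by
  rw [← not_le, ← not_le, le_iff_code]

instance : WellFoundedLT StarNat :=
  ⟨Subrelation.wf (fun {A B} h => (lt_iff_code A B).1 h) (InvImage.wf code wellFounded_lt)⟩

/-- `x ⊕ y = x + y`, `x* ⊕ y = x ⊕ y* = (x + y)*`, `x* ⊕ y* = x + y + 1`. -/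
def oplus : StarNat → StarNat → StarNat
  | ⟨x, false⟩, ⟨y, false⟩ => ⟨x + y, false⟩
  | ⟨x, true⟩, ⟨y, false⟩ => ⟨x + y, true⟩
  | ⟨x, false⟩, ⟨y, true⟩ => ⟨x + y, true⟩
  | ⟨x, true⟩, ⟨y, true⟩ => ⟨x + y + 1, false⟩

/-- `x ⊖ y = x - y`, `x* ⊖ y = (x - y)*`, `x* ⊖ y* = x - y`, `x ⊖ y* = (x - y - 1)*`.
Below it is applied only where the subtrahend does not exceed the minuend. -/
def ominus : StarNat → StarNat → StarNat
  | ⟨x, false⟩, ⟨y, false⟩ => ⟨x - y, false⟩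
  | ⟨x, true⟩, ⟨y, false⟩ => ⟨x - y, true⟩
  | ⟨x, true⟩, ⟨y, true⟩ => ⟨x - y, false⟩
  | ⟨x, false⟩, ⟨y, true⟩ => ⟨x - y - 1, true⟩

/-- `b` is a legal bid for a player whose budget is `B`: it is within the budget, and it uses the
advantage only if the player holds it. -/
def LegalBid (B b : StarNat) : Prop := b ≤ B ∧ (b.adv = true → B.adv = true)

theorem ominus_le {B b : StarNat} (h : LegalBid B b) : B.ominus b ≤ B := by
  obtain ⟨x, a⟩ := B
  obtain ⟨y, c⟩ := b
  cases a <;> cases c <;> simp [LegalBid, le_iff_code, code, ominus] at h ⊢ <;> omega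

theorem oplus_le {k : ℕ} {B b : StarNat} (hB : B ≤ ⟨k, true⟩)
    (h : LegalBid (ominus ⟨k, true⟩ B) b) : B.oplus b ≤ ⟨k, true⟩ := by
  obtain ⟨x, a⟩ := B
  obtain ⟨y, c⟩ := b
  cases a <;> cases c <;> simp [LegalBid, le_iff_code, code, ominus, oplus] at h hB ⊢ <;> omega

end StarNat

/-- An energy bidding game `⟨V, E, k, w⟩`: a directed graph in which every vertex has a neighbour,
a total budget `k`, and integer weights on the edges (the values of `weight` on pairs that are not
edges are never used). The players are Preserver (Player 1) and Consumer (Player 2). -/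
structure EnergyGame (V : Type*) where
  /-- `Edge v u` says that `(v, u)` is an edge. -/
  Edge : V → V → Prop
  exists_edge : ∀ v, ∃ u, Edge v u
  /-- The total budget. -/
  k : ℕ
  /-- The weight function. -/
  weight : V → V → ℤ

namespace EnergyGame

variable {V : Type*} (G : EnergyGame V)

/-- The set `[k] = {0, 0*, …, k, k*}`. -/
def Budget : Type := {B : StarNat // B ≤ ⟨G.k, true⟩}

/-- The set `[k] ∪ {k + 1}`, in which `k + 1` is the successor of `k*`. -/
def ExtBudget : Type := {B : StarNat // B ≤ ⟨G.k + 1, false⟩}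

/-- Configurations `⟨v, B⟩`: the token is at `v` and Preserver's budget is `B`. -/
abbrev Config : Type _ := V × G.Budget

/-- Consumer's budget `k* ⊖ B` when Preserver's budget is `B`. -/
def consBudget (B : G.Budget) : StarNat := StarNat.ominus ⟨G.k, true⟩ B.1

/-- Preserver's allowed actions: a legal bid and a neighbour to move to upon winning it. -/
def PresAction (c : G.Config) : Type _ :=
  {a : StarNat × V // StarNat.LegalBid c.2.1 a.1 ∧ G.Edge c.1 a.2}

/-- Consumer's allowed actions: a legal bid and a neighbour to move to upon winning it. -/
def ConsAction (c : G.Config) : Type _ :=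
  {a : StarNat × V // StarNat.LegalBid (G.consBudget c.2) a.1 ∧ G.Edge c.1 a.2}

open Classical in
/-- The transition function. The higher bidder pays his bid to the other player and moves the
token; equal bids are won by the player who does not hold the advantage. -/
noncomputable def step (c : G.Config) (a : G.PresAction c) (b : G.ConsAction c) : G.Config :=
  if b.1.1 < a.1.1 ∨ (a.1.1 = b.1.1 ∧ c.2.1.adv = false) then
    (a.1.2, ⟨c.2.1.ominus a.1.1, (StarNat.ominus_le a.2.1).trans c.2.2⟩)
  else
    (b.1.2, ⟨c.2.1.oplus b.1.1, StarNat.oplus_le c.2.2 b.2.1⟩)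

/-- A strategy of Preserver maps each history, given as the list of the past configurations and
the current one, to an allowed action. -/
def PresStrategy : Type _ := List G.Config → (c : G.Config) → G.PresAction c

/-- A strategy of Consumer. -/
def ConsStrategy : Type _ := List G.Config → (c : G.Config) → G.ConsAction c

/-- The play from `c₀` under two strategies: after `m` turns, the list of the past `m`
configurations in order, and the current one. -/
noncomputable def play (c₀ : G.Config) (σ : G.PresStrategy) (τ : G.ConsStrategy) :
    ℕ → List G.Config × G.Config
  | 0 => ([], c₀)
  | m + 1 =>
    let h := play c₀ σ τ m
    (h.1 ++ [h.2], G.step h.2 (σ h.1 h.2) (τ h.1 h.2))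

/-- The path of vertices that corresponds to a play. -/
noncomputable def path (c₀ : G.Config) (σ : G.PresStrategy) (τ : G.ConsStrategy) (m : ℕ) : V :=
  (G.play c₀ σ τ m).2.1

/-- The sum of the weights of the first `m` edges of a path. -/
def energySum (π : ℕ → V) (m : ℕ) : ℤ :=
  ∑ j ∈ Finset.range m, G.weight (π j) (π (j + 1))

/-- Preserver `M`-wins from `c`. The initial energy is an integer so that `M - 1` makes sense for
`M = 0`; with a negative initial energy Consumer wins at once. -/
def PresWins (M : ℤ) (c : G.Config) : Prop :=
  ∃ σ : G.PresStrategy, ∀ τ : G.ConsStrategy, ∀ m, 0 ≤ M + G.energySum (G.path c σ τ) m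

/-- Consumer `M`-wins from `c`. -/
def ConsWins (M : ℤ) (c : G.Config) : Prop :=
  ∃ τ : G.ConsStrategy, ∀ σ : G.PresStrategy, ∃ m, M + G.energySum (G.path c σ τ) m < 0

/-- `en` is the energy threshold of the game. -/
def IsEnergyThreshold (en : V → G.Budget → ℕ∞) : Prop :=
  ∀ v B,
    (∀ M : ℕ, en v B = M → G.PresWins M (v, B) ∧ G.ConsWins ((M : ℤ) - 1) (v, B)) ∧
    (en v B = ⊤ → ∀ M : ℕ, G.ConsWins M (v, B))

/-- The budgets in `[k]` at which the energy threshold at `v` is finite. -/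
def finiteBudgets (en : V → G.Budget → ℕ∞) (v : V) : Set StarNat :=
  {B | ∃ h : B ≤ ⟨G.k, true⟩, en v ⟨B, h⟩ < ⊤}

open Classical in
/-- The threshold budget: the least budget in `[k]` at which the energy threshold is finite, and
`k + 1` if there is none. -/
noncomputable def threshold (en : V → G.Budget → ℕ∞) (v : V) : G.ExtBudget :=
  if h : (G.finiteBudgets en v).Nonempty then
    ⟨wellFounded_lt.min (G.finiteBudgets en v) h, by
      obtain ⟨hk, -⟩ := wellFounded_lt.min_mem (G.finiteBudgets en v) h
      refine hk.trans ?_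
      simp only [StarNat.le_iff_code, StarNat.code, Bool.toNat_true, Bool.toNat_false]
      omega⟩
  else ⟨⟨G.k + 1, false⟩, le_rfl⟩

/-- The correction `ε ∈ {0, 1, *}`, where `*` is `0* ∈ ℕ*`, as a function of the maximal value
`p` and the minimal value `q` among the neighbours. -/
def epsilon (p q : StarNat) : StarNat :=
  if Even (p.int + q.int) ∧ q.adv = false then ⟨0, false⟩
  else if Odd (p.int + q.int) ∧ q.adv = true then ⟨1, false⟩
  else ⟨0, true⟩

/-- The average property of `T : V → [k] ∪ {k + 1}`:
`T(v) = ⌊(|T(v⁺)| + |T(v⁻)|) / 2⌋ + ε` for every vertex `v`, every neighbour `v⁺` with maximal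
and every neighbour `v⁻` with minimal value of `T`. -/
def AverageProperty (T : V → G.ExtBudget) : Prop :=
  ∀ v vp vm : V,
    G.Edge v vp → (∀ u, G.Edge v u → (T u).1 ≤ (T vp).1) →
    G.Edge v vm → (∀ u, G.Edge v u → (T vm).1 ≤ (T u).1) →
    (T v).1 =
      StarNat.oplus ⟨((T vp).1.int + (T vm).1.int) / 2, false⟩ (epsilon (T vp).1 (T vm).1)

end EnergyGame

/-! Encode `x` as `2x` and `x*` as `2x + 1`. Then `⊕` and `⊖` become addition and subtraction, and
the advantage is the parity of a budget. The two budgets have codes summing to `2k + 1`, so exactly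
one is odd, and only its owner may bid an odd number. One turn is determined. If the winning set is
upward closed in the budget, each neighbour has a threshold. Preserver can force it exactly when his
budget reaches the average of the extreme thresholds: he bids towards `v⁻`, or else Consumer bids
towards `v⁺` (`exists_presAction_iff`). By induction, surviving `n` turns is monotone in the budget
and determined. As there are finitely many actions, surviving every finite horizon (`Safe`) can be
maintained turn by turn, so `Safe` decides who wins, and the least safe energy is the energy
threshold. Finiteness of this energy is itself a one-turn condition (`exists_safe_iff`), so the
one-turn analysis gives the average property. -/

namespace StarNat

/-- The element of `ℕ*` at a given position of the order. -/
def ofCode (n : ℕ) : StarNat := ⟨n / 2, decide (n % 2 = 1)⟩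

theorem code_ofCode (n : ℕ) : (ofCode n).code = n := by
  rcases Nat.mod_two_eq_zero_or_one n with h | h <;> simp [ofCode, code, h] <;> omega

theorem adv_eq_true_iff (B : StarNat) : B.adv = true ↔ B.code % 2 = 1 := by
  obtain ⟨x, a⟩ := B
  cases a <;> simp [code]

theorem adv_eq_false_iff (B : StarNat) : B.adv = false ↔ B.code % 2 = 0 := by
  obtain ⟨x, a⟩ := B
  cases a <;> simp [code]

theorem int_eq (B : StarNat) : B.int = B.code / 2 := by
  have := B.adv.toNat_lt
  rw [code]
  omega

theorem code_oplus (A B : StarNat) : (A.oplus B).code = A.code + B.code := by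
  obtain ⟨x, a⟩ := A
  obtain ⟨y, b⟩ := B
  cases a <;> cases b <;> simp [code, oplus] <;> omega

theorem code_ominus {A B : StarNat} (h : B ≤ A) : (A.ominus B).code = A.code - B.code := by
  obtain ⟨x, a⟩ := A
  obtain ⟨y, b⟩ := B
  rw [le_iff_code] at h
  cases a <;> cases b <;> simp [code, ominus] at h ⊢ <;> omega

theorem legalBid_iff (B b : StarNat) :
    LegalBid B b ↔ b.code ≤ B.code ∧ (b.code % 2 = 1 → B.code % 2 = 1) := by
  rw [LegalBid, le_iff_code, adv_eq_true_iff, adv_eq_true_iff]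

theorem finite_Iic (X : StarNat) : {B : StarNat | B ≤ X}.Finite :=
  (Set.finite_Iic X.code).preimage code_injective.injOn

end StarNat

/-! ### One turn of bidding -/

namespace EnergyGame

open StarNat

variable {V : Type*} (G : EnergyGame V)

/-- The right-hand side of the average property. -/
def average (p q : StarNat) : StarNat :=
  StarNat.oplus ⟨(p.int + q.int) / 2, false⟩ (epsilon p q)

theorem code_average (p q : StarNat) :
    (average p q).code = 2 * ((p.code / 2 + q.code / 2) / 2) +
      if (p.code / 2 + q.code / 2) % 2 = 0 ∧ q.code % 2 = 0 then 0
      else if (p.code / 2 + q.code / 2) % 2 = 1 ∧ q.code % 2 = 1 then 2 else 1 := by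
  rw [average, code_oplus, epsilon]
  simp only [int_eq, adv_eq_true_iff, adv_eq_false_iff, Nat.even_iff, Nat.odd_iff]
  split_ifs <;> simp [code]

theorem average_le {p q : StarNat} (h : q ≤ p) {n : ℕ} (hp : p ≤ ⟨n, false⟩) :
    average p q ≤ ⟨n, false⟩ := by
  rw [le_iff_code] at h hp ⊢
  change _ ≤ 2 * n at hp
  change _ ≤ 2 * n
  rw [code_average]
  split_ifs <;> omega

variable {G}

theorem code_budget_le (B : G.Budget) : B.1.code ≤ 2 * G.k + 1 := B.2

theorem code_consBudget (B : G.Budget) : (G.consBudget B).code = 2 * G.k + 1 - B.1.code := by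
  rw [consBudget, code_ominus B.2]
  rfl

theorem step_of_pres_wins {c : G.Config} (a : G.PresAction c) (b : G.ConsAction c)
    (h : b.1.1.code < a.1.1.code ∨ a.1.1.code = b.1.1.code ∧ c.2.1.code % 2 = 0) :
    (G.step c a b).1 = a.1.2 ∧ (G.step c a b).2.1.code = c.2.1.code - a.1.1.code := by
  rw [← lt_iff_code, code_injective.eq_iff, ← adv_eq_false_iff] at h
  rw [step, if_pos h]
  exact ⟨rfl, code_ominus a.2.1.1⟩

theorem step_of_cons_wins {c : G.Config} (a : G.PresAction c) (b : G.ConsAction c)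
    (h : ¬ (b.1.1.code < a.1.1.code ∨ a.1.1.code = b.1.1.code ∧ c.2.1.code % 2 = 0)) :
    (G.step c a b).1 = b.1.2 ∧ (G.step c a b).2.1.code = c.2.1.code + b.1.1.code := by
  rw [← lt_iff_code, code_injective.eq_iff, ← adv_eq_false_iff] at h
  rw [step, if_neg h]
  exact ⟨rfl, code_oplus _ _⟩

theorem edge_step (c : G.Config) (a : G.PresAction c) (b : G.ConsAction c) :
    G.Edge c.1 (G.step c a b).1 := by
  rw [step]
  split_ifs
  exacts [a.2.2, b.2.2]

/-- A budget that reaches the average lets Preserver move to a configuration whose budget reaches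
the value `T` of its vertex. -/
theorem exists_presAction_of_average_le (T : V → StarNat) (c : G.Config) {vp vm : V}
    (hp : ∀ u, G.Edge c.1 u → T u ≤ T vp) (hm : G.Edge c.1 vm) (hmp : T vm ≤ T vp)
    (hB : average (T vp) (T vm) ≤ c.2.1) :
    ∃ a : G.PresAction c, ∀ b : G.ConsAction c, T (G.step c a b).1 ≤ (G.step c a b).2.1 := by
  set x := c.2.1.code with hx
  set p := (T vp).code with hpc
  set q := (T vm).code with hqc
  have hqp : q ≤ p := hmp
  rw [le_iff_code, code_average, ← hpc, ← hqc, ← hx] at hB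
  -- `d` is the largest legal bid that leaves at least `q` when paid. If it loses and `x` is odd,
  -- Consumer's bid is even and at least `d`, hence at least `d + d % 2`; if `x` is even, Preserver
  -- wins ties, so Consumer's bid is at least `d + 1`.
  obtain ⟨d, hd, hdx, hodd, heven⟩ : ∃ d, (d % 2 = 1 → x % 2 = 1) ∧ q + d ≤ x ∧
      (x % 2 = 1 → p ≤ x + (d + d % 2)) ∧ (x % 2 = 0 → p ≤ x + 1 + d) := by
    rcases Nat.mod_two_eq_zero_or_one x with h | h
    · refine ⟨2 * ((x - q) / 2), ?_, ?_, ?_, ?_⟩ <;> split_ifs at hB <;> omega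
    · refine ⟨x - q, ?_, ?_, ?_, ?_⟩ <;> split_ifs at hB <;> omega
  have hlegal : LegalBid c.2.1 (ofCode d) := by
    rw [legalBid_iff, code_ofCode]
    exact ⟨by omega, hd⟩
  let a : G.PresAction c := ⟨(ofCode d, vm), hlegal, hm⟩
  refine ⟨a, fun b => ?_⟩
  have had : a.1.1.code = d := code_ofCode d
  have hb := b.2.1
  rw [legalBid_iff, code_consBudget, ← hx] at hb
  have hxk := code_budget_le c.2
  rw [← hx] at hxk
  by_cases h : b.1.1.code < a.1.1.code ∨ a.1.1.code = b.1.1.code ∧ c.2.1.code % 2 = 0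
  · obtain ⟨h1, h2⟩ := step_of_pres_wins a b h
    rw [le_iff_code, h1, h2, had]
    change q ≤ x - d
    omega
  · obtain ⟨h1, h2⟩ := step_of_cons_wins a b h
    refine (hp _ (edge_step c a b)).trans ?_
    rw [le_iff_code, h2]
    change p ≤ x + _
    rw [had, ← hx] at h
    omega

/-- A budget below the average lets Consumer move to a configuration whose budget is below the
value `T` of its vertex. -/
theorem exists_consAction_of_lt_average (T : V → StarNat) (hT : ∀ u, T u ≤ ⟨G.k + 1, false⟩)
    (c : G.Config) {vp vm : V} (hp : G.Edge c.1 vp) (hm : ∀ u, G.Edge c.1 u → T vm ≤ T u)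
    (hB : c.2.1 < average (T vp) (T vm)) :
    ∃ b : G.ConsAction c, ∀ a : G.PresAction c, (G.step c a b).2.1 < T (G.step c a b).1 := by
  set x := c.2.1.code with hx
  set p := (T vp).code with hpc
  set q := (T vm).code with hqc
  have hqp : q ≤ p := hm vp hp
  have hpk : p ≤ 2 * (G.k + 1) := hT vp
  have hxk := code_budget_le c.2
  rw [← hx] at hxk
  rw [lt_iff_code, code_average, ← hpc, ← hqc, ← hx] at hB
  -- For even `x`, `d` is the largest bid keeping `x + d` below `p`; a Preserver bid beating it is
  -- even and at least `d`. For odd `x`, `d` must be even and is `x - q` rounded up; a Preserver bid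
  -- beating it is at least `d + 1`.
  obtain ⟨d, hd, hdx, hodd, heven⟩ : ∃ d, (d % 2 = 1 → x % 2 = 0) ∧ x + d < p ∧
      (x % 2 = 1 → x < q + (d + 1)) ∧ (x % 2 = 0 → x < q + (d + d % 2)) := by
    rcases Nat.mod_two_eq_zero_or_one x with h | h
    · refine ⟨p - x - 1, ?_, ?_, ?_, ?_⟩ <;> split_ifs at hB <;> omega
    · refine ⟨2 * ((x - q + 1) / 2), ?_, ?_, ?_, ?_⟩ <;> split_ifs at hB <;> omega
  have hlegal : LegalBid (G.consBudget c.2) (ofCode d) := by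
    rw [legalBid_iff, code_ofCode, code_consBudget]
    omega
  let b : G.ConsAction c := ⟨(ofCode d, vp), hlegal, hp⟩
  refine ⟨b, fun a => ?_⟩
  have hbd : b.1.1.code = d := code_ofCode d
  have ha := a.2.1
  rw [legalBid_iff, ← hx] at ha
  by_cases h : b.1.1.code < a.1.1.code ∨ a.1.1.code = b.1.1.code ∧ c.2.1.code % 2 = 0
  · obtain ⟨h1, h2⟩ := step_of_pres_wins a b h
    refine lt_of_lt_of_le ?_ (hm _ (edge_step c a b))
    rw [lt_iff_code, h2]
    change x - _ < q
    rw [hbd, ← hx] at h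
    omega
  · obtain ⟨h1, h2⟩ := step_of_cons_wins a b h
    rw [lt_iff_code, h1, h2, hbd]
    exact hdx

variable (G) in
/-- The least budget that satisfies `P`, and `k + 1` if there is none. -/
noncomputable def leastBudget (P : G.Budget → Prop) : StarNat :=
  open Classical in
  if h : {B | ∃ hB : B ≤ ⟨G.k, true⟩, P ⟨B, hB⟩}.Nonempty then
    wellFounded_lt.min {B | ∃ hB : B ≤ ⟨G.k, true⟩, P ⟨B, hB⟩} h
  else ⟨G.k + 1, false⟩

theorem leastBudget_le (P : G.Budget → Prop) : G.leastBudget P ≤ ⟨G.k + 1, false⟩ := by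
  rw [leastBudget]
  split_ifs with h
  · obtain ⟨hk, -⟩ := wellFounded_lt.min_mem _ h
    refine hk.trans ?_
    simp only [le_iff_code, code, Bool.toNat_true, Bool.toNat_false]
    omega
  · exact le_rfl

theorem leastBudget_le_iff {P : G.Budget → Prop}
    (hP : ∀ B B' : G.Budget, B.1 ≤ B'.1 → P B → P B') (B : G.Budget) :
    G.leastBudget P ≤ B.1 ↔ P B := by
  rw [leastBudget]
  split_ifs with h
  · refine ⟨fun hB => ?_, fun hB =>
      wellFounded_lt.min_le (s := {B | ∃ hB : B ≤ ⟨G.k, true⟩, P ⟨B, hB⟩}) ⟨B.2, hB⟩⟩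
    obtain ⟨hk, hm⟩ := wellFounded_lt.min_mem _ h
    exact hP _ _ hB hm
  · refine ⟨fun hB => ?_, fun hB => (h ⟨B.1, B.2, hB⟩).elim⟩
    have := code_budget_le B
    rw [le_iff_code] at hB
    simp [code] at hB this
    omega

/-- The bidding for one turn is determined: the winner depends on how Preserver's budget compares
with the average of the extreme thresholds of the neighbours. -/
theorem exists_presAction_iff {P : G.Config → Prop}
    (hP : ∀ u (B B' : G.Budget), B.1 ≤ B'.1 → P (u, B) → P (u, B')) (c : G.Config) {vp vm : V}
    (hvp : G.Edge c.1 vp)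
    (hp : ∀ u, G.Edge c.1 u → G.leastBudget (fun B => P (u, B)) ≤ G.leastBudget fun B => P (vp, B))
    (hvm : G.Edge c.1 vm)
    (hm : ∀ u, G.Edge c.1 u → G.leastBudget (fun B => P (vm, B)) ≤ G.leastBudget fun B => P (u, B)) :
    (∃ a, ∀ b, P (G.step c a b)) ↔
      average (G.leastBudget fun B => P (vp, B)) (G.leastBudget fun B => P (vm, B)) ≤ c.2.1 := by
  constructor
  · rintro ⟨a, ha⟩
    by_contra h
    obtain ⟨b, hb⟩ := exists_consAction_of_lt_average (fun u => G.leastBudget fun B => P (u, B))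
      (fun u => leastBudget_le _) c hvp hm (not_le.1 h)
    exact (hb a).not_ge ((leastBudget_le_iff (hP _) _).2 (ha b))
  · intro h
    obtain ⟨a, ha⟩ := exists_presAction_of_average_le (fun u => G.leastBudget fun B => P (u, B))
      c hp hvm (hm _ hvp) h
    exact ⟨a, fun b => (leastBudget_le_iff (hP _) _).1 (ha b)⟩

/-! ### Determinacy and monotonicity of one turn -/

section Local

variable [Finite V]

theorem exists_extreme_neighbours (T : V → StarNat) (v : V) :
    ∃ vp vm, G.Edge v vp ∧ (∀ u, G.Edge v u → T u ≤ T vp) ∧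
      G.Edge v vm ∧ ∀ u, G.Edge v u → T vm ≤ T u := by
  obtain ⟨vp, h1, h2⟩ := Set.exists_max_image {u | G.Edge v u} T (Set.toFinite _) (G.exists_edge v)
  obtain ⟨vm, h3, h4⟩ := Set.exists_min_image {u | G.Edge v u} T (Set.toFinite _) (G.exists_edge v)
  exact ⟨vp, vm, h1, h2, h3, h4⟩

theorem exists_consAction_of_not {P : G.Config → Prop}
    (hP : ∀ u (B B' : G.Budget), B.1 ≤ B'.1 → P (u, B) → P (u, B')) (c : G.Config)
    (h : ¬ ∃ a, ∀ b, P (G.step c a b)) : ∃ b, ∀ a, ¬ P (G.step c a b) := by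
  obtain ⟨vp, vm, h1, h2, h3, h4⟩ :=
    exists_extreme_neighbours (G := G) (fun u => G.leastBudget fun B => P (u, B)) c.1
  rw [exists_presAction_iff hP c h1 h2 h3 h4, not_le] at h
  obtain ⟨b, hb⟩ := exists_consAction_of_lt_average (fun u => G.leastBudget fun B => P (u, B))
    (fun u => leastBudget_le _) c h1 h4 h
  exact ⟨b, fun a ha => (hb a).not_ge ((leastBudget_le_iff (hP _) _).2 ha)⟩

/-- Copying the action is not enough, since a larger budget may lack the advantage. The comparison
with the average, however, is monotone. -/
theorem exists_presAction_mono {P : G.Config → Prop}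
    (hP : ∀ u (B B' : G.Budget), B.1 ≤ B'.1 → P (u, B) → P (u, B')) {v : V} {B B' : G.Budget}
    (hB : B.1 ≤ B'.1) (h : ∃ a, ∀ b, P (G.step (v, B) a b)) :
    ∃ a, ∀ b, P (G.step (v, B') a b) := by
  obtain ⟨vp, vm, h1, h2, h3, h4⟩ :=
    exists_extreme_neighbours (G := G) (fun u => G.leastBudget fun B => P (u, B)) v
  rw [exists_presAction_iff hP (v, B) h1 h2 h3 h4] at h
  rw [exists_presAction_iff hP (v, B') h1 h2 h3 h4]
  exact h.trans hB

instance (c : G.Config) : Finite (G.PresAction c) :=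
  Set.Finite.to_subtype (((finite_Iic c.2.1).prod Set.finite_univ).subset
    fun _ ha => ⟨ha.1.1, trivial⟩)

instance (c : G.Config) : Finite (G.ConsAction c) :=
  Set.Finite.to_subtype (((finite_Iic (G.consBudget c.2)).prod Set.finite_univ).subset
    fun _ ha => ⟨ha.1.1, trivial⟩)

end Local

/-! ### Survival for finitely many turns and safety -/

variable (G) in
/-- From `c` with energy `e`, Preserver can keep the energy nonnegative for `n` turns. -/
def Survives : ℕ → G.Config → ℤ → Prop
  | 0, _, e => 0 ≤ e
  | n + 1, c, e => 0 ≤ e ∧ ∃ a : G.PresAction c, ∀ b : G.ConsAction c,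
      Survives n (G.step c a b) (e + G.weight c.1 (G.step c a b).1)

variable (G) in
/-- From `c` with energy `e`, Preserver can keep the energy nonnegative for any number of turns. -/
def Safe (c : G.Config) (e : ℤ) : Prop := ∀ n, G.Survives n c e

theorem Survives.nonneg {n : ℕ} {c : G.Config} {e : ℤ} (h : G.Survives n c e) : 0 ≤ e := by
  cases n
  exacts [h, h.1]

theorem Survives.mono_energy {n : ℕ} {c : G.Config} {e e' : ℤ} (he : e ≤ e')
    (h : G.Survives n c e) : G.Survives n c e' := by
  induction n generalizing c e e' with
  | zero => exact le_trans h he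
  | succ n ih =>
    obtain ⟨h0, a, ha⟩ := h
    exact ⟨h0.trans he, a, fun b => ih (by lia) (ha b)⟩

theorem Survives.of_succ {n : ℕ} {c : G.Config} {e : ℤ} (h : G.Survives (n + 1) c e) :
    G.Survives n c e := by
  induction n generalizing c e with
  | zero => exact h.1
  | succ n ih =>
    obtain ⟨h0, a, ha⟩ := h
    exact ⟨h0, a, fun b => ih (ha b)⟩

theorem Survives.anti_turns {n m : ℕ} (hnm : n ≤ m) {c : G.Config} {e : ℤ}
    (h : G.Survives m c e) : G.Survives n c e := by
  induction hnm with
  | refl => exact h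
  | step _ ih => exact ih h.of_succ

theorem Safe.mono_energy {c : G.Config} {e e' : ℤ} (he : e ≤ e') (h : G.Safe c e) :
    G.Safe c e' := fun n => (h n).mono_energy he

theorem safe_of_exists_presAction {c : G.Config} {e : ℤ} (h0 : 0 ≤ e)
    (h : ∃ a : G.PresAction c, ∀ b : G.ConsAction c,
      G.Safe (G.step c a b) (e + G.weight c.1 (G.step c a b).1)) : G.Safe c e := by
  obtain ⟨a, ha⟩ := h
  intro n
  cases n with
  | zero => exact h0
  | succ n => exact ⟨h0, a, fun b => ha b n⟩

section Finite

variable [Finite V]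

theorem Survives.mono_budget {n : ℕ} {u : V} {B B' : G.Budget} (hB : B.1 ≤ B'.1) {e : ℤ}
    (h : G.Survives n (u, B) e) : G.Survives n (u, B') e := by
  induction n generalizing u B B' e with
  | zero => exact h
  | succ n ih =>
    exact ⟨h.1, exists_presAction_mono
      (P := fun c => G.Survives n c (e + G.weight u c.1)) (fun _ _ _ hB' => ih hB') hB h.2⟩

theorem Safe.mono_budget {u : V} {B B' : G.Budget} (hB : B.1 ≤ B'.1) {e : ℤ}
    (h : G.Safe (u, B) e) : G.Safe (u, B') e := fun n => (h n).mono_budget hB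

theorem exists_consAction_of_not_survives {n : ℕ} {c : G.Config} {e : ℤ} (h0 : 0 ≤ e)
    (h : ¬ G.Survives (n + 1) c e) : ∃ b : G.ConsAction c, ∀ a : G.PresAction c,
      ¬ G.Survives n (G.step c a b) (e + G.weight c.1 (G.step c a b).1) :=
  exists_consAction_of_not (P := fun c' => G.Survives n c' (e + G.weight c.1 c'.1))
    (fun _ _ _ hB => Survives.mono_budget hB) c fun h' => h ⟨h0, h'⟩

/-- Compactness: if every action could be refuted at some horizon, the largest of these finitely
many horizons would refute all actions at once. -/
theorem Safe.exists_presAction {c : G.Config} {e : ℤ} (h : G.Safe c e) :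
    ∃ a : G.PresAction c, ∀ b : G.ConsAction c,
      G.Safe (G.step c a b) (e + G.weight c.1 (G.step c a b).1) := by
  by_contra! hn
  simp only [Safe, not_forall] at hn
  choose b n hn using hn
  obtain ⟨N, hN⟩ := (Set.finite_range n).bddAbove
  obtain ⟨a, ha⟩ := (h (N + 1)).2
  exact hn a ((ha (b a)).anti_turns (hN ⟨a, rfl⟩))

/-- Finiteness of the required energy is decided by one turn of bidding. -/
theorem exists_safe_iff (c : G.Config) :
    (∃ M : ℕ, G.Safe c M) ↔
      ∃ a : G.PresAction c, ∀ b : G.ConsAction c, ∃ M : ℕ, G.Safe (G.step c a b) M := by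
  constructor
  · rintro ⟨M, hM⟩
    obtain ⟨a, ha⟩ := hM.exists_presAction
    exact ⟨a, fun b => ⟨_, (ha b).mono_energy (Int.self_le_toNat _)⟩⟩
  · rintro ⟨a, ha⟩
    choose M hM using ha
    -- `N` covers, for each of the finitely many answers, the energy needed afterwards minus the
    -- weight of the edge.
    obtain ⟨N, hN⟩ := (Set.finite_range fun b : G.ConsAction c =>
      ((M b : ℤ) - G.weight c.1 (G.step c a b).1).toNat).bddAbove
    refine ⟨N, safe_of_exists_presAction (Int.natCast_nonneg N)
      ⟨a, fun b => (hM b).mono_energy ?_⟩⟩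
    have := hN ⟨b, rfl⟩
    dsimp only at this
    lia

end Finite

/-! ### From safety to strategies -/

theorem energySum_succ (π : ℕ → V) (m : ℕ) :
    G.energySum π (m + 1) = G.energySum π m + G.weight (π m) (π (m + 1)) :=
  Finset.sum_range_succ _ _

theorem play_succ (c : G.Config) (σ : G.PresStrategy) (τ : G.ConsStrategy) (m : ℕ) :
    G.play c σ τ (m + 1) = ((G.play c σ τ m).1 ++ [(G.play c σ τ m).2],
      G.step (G.play c σ τ m).2 (σ (G.play c σ τ m).1 (G.play c σ τ m).2)
        (τ (G.play c σ τ m).1 (G.play c σ τ m).2)) := rfl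

instance (c : G.Config) : Nonempty (G.PresAction c) := by
  obtain ⟨u, hu⟩ := G.exists_edge c.1
  exact ⟨⟨(ofCode 0, u), (legalBid_iff _ _).2 (by simp [code_ofCode]), hu⟩⟩

instance (c : G.Config) : Nonempty (G.ConsAction c) := by
  obtain ⟨u, hu⟩ := G.exists_edge c.1
  exact ⟨⟨(ofCode 0, u), (legalBid_iff _ _).2 (by simp [code_ofCode]), hu⟩⟩

/-- A positional strategy suffices: an action that preserves safety from the least safe energy does
so from any larger energy, the surplus being carried along. -/
theorem presWins_of_safe [Finite V] {c : G.Config} {e : ℤ} (h : G.Safe c e) :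
    G.PresWins e c := by
  classical
  have key (c : G.Config) : ∃ a : G.PresAction c, ∀ e : ℤ, G.Safe c e → ∀ b : G.ConsAction c,
      G.Safe (G.step c a b) (e + G.weight c.1 (G.step c a b).1) := by
    by_cases hc : ∃ M : ℕ, G.Safe c M
    · obtain ⟨a, ha⟩ := (Nat.find_spec hc).exists_presAction
      refine ⟨a, fun e he b => (ha b).mono_energy ?_⟩
      have h0 : 0 ≤ e := he 0
      have := Nat.find_min' hc (m := e.toNat) (he.mono_energy (Int.self_le_toNat e))
      lia
    · exact ⟨Classical.arbitrary _, fun e he =>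
        (hc ⟨e.toNat, he.mono_energy (Int.self_le_toNat e)⟩).elim⟩
  choose a ha using key
  refine ⟨fun _ c => a c, fun τ m => ?_⟩
  suffices H : G.Safe (G.play c (fun _ c => a c) τ m).2
      (e + G.energySum (G.path c (fun _ c => a c) τ) m) from H 0
  induction m with
  | zero => simpa [energySum, play] using h
  | succ m ih =>
    rw [energySum_succ, ← add_assoc]
    exact ha _ _ ih _

variable (G) in
/-- The sum of the weights along a history. -/
def historySum : List G.Config → G.Config → ℤ
  | [], _ => 0
  | [x], c => G.weight x.1 c.1
  | x :: y :: l, c => G.weight x.1 y.1 + historySum (y :: l) c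

theorem historySum_append (l : List G.Config) (x c : G.Config) :
    G.historySum (l ++ [x]) c = G.historySum l x + G.weight x.1 c.1 := by
  induction l with
  | nil => simp [historySum]
  | cons y l ih =>
    cases l with
    | nil => simp [historySum]
    | cons z l =>
      simp only [List.cons_append, historySum] at ih ⊢
      rw [ih, add_assoc]

theorem historySum_play (c : G.Config) (σ : G.PresStrategy) (τ : G.ConsStrategy) (m : ℕ) :
    G.historySum (G.play c σ τ m).1 (G.play c σ τ m).2 = G.energySum (G.path c σ τ) m := by
  induction m with
  | zero => rfl
  | succ m ih =>
    rw [energySum_succ, ← ih, play_succ, historySum_append]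
    rfl

theorem length_play (c : G.Config) (σ : G.PresStrategy) (τ : G.ConsStrategy) (m : ℕ) :
    (G.play c σ τ m).1.length = m := by
  induction m with
  | zero => rfl
  | succ m ih => simp [play_succ, ih]

/-- Consumer reads the number of turns left and the current energy off the history and keeps
Preserver unable to survive the remaining turns; with none left the energy is negative. -/
theorem consWins_of_not_survives [Finite V] {n : ℕ} {c : G.Config} {e : ℤ}
    (h : ¬ G.Survives n c e) : G.ConsWins e c := by
  have key (j : ℕ) (e : ℤ) (c : G.Config) : ∃ b : G.ConsAction c,
      0 ≤ e → ¬ G.Survives (j + 1) c e → ∀ a : G.PresAction c,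
        ¬ G.Survives j (G.step c a b) (e + G.weight c.1 (G.step c a b).1) := by
    by_cases hc : 0 ≤ e ∧ ¬ G.Survives (j + 1) c e
    · obtain ⟨b, hb⟩ := exists_consAction_of_not_survives hc.1 hc.2
      exact ⟨b, fun _ _ => hb⟩
    · exact ⟨Classical.arbitrary _, fun h1 h2 => (hc ⟨h1, h2⟩).elim⟩
  choose b hb using key
  let τ : G.ConsStrategy := fun l c => b (n - (l.length + 1)) (e + G.historySum l c) c
  refine ⟨τ, fun σ => ?_⟩
  by_contra! hpos
  suffices H : ∀ m ≤ n, ¬ G.Survives (n - m) (G.play c σ τ m).2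
      (e + G.energySum (G.path c σ τ) m) by
    have := H n le_rfl
    rw [Nat.sub_self] at this
    exact this (hpos n)
  intro m hm
  induction m with
  | zero => simpa [energySum, play] using h
  | succ m ih =>
    have h1 := ih (by omega)
    rw [show n - m = n - (m + 1) + 1 by omega] at h1
    have h2 := hb _ _ _ (hpos m) h1 (σ (G.play c σ τ m).1 (G.play c σ τ m).2)
    have h3 : τ (G.play c σ τ m).1 (G.play c σ τ m).2 =
        b (n - (m + 1)) (e + G.energySum (G.path c σ τ) m) (G.play c σ τ m).2 := by
      change b (n - ((G.play c σ τ m).1.length + 1)) (e + G.historySum (G.play c σ τ m).1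
        (G.play c σ τ m).2) _ = _
      rw [length_play, historySum_play]
    rw [← h3] at h2
    rw [energySum_succ, ← add_assoc]
    exact h2

/-! ### The energy threshold and the average property -/

theorem PresWins.lt_of_consWins {c : G.Config} {M M' : ℤ} (h : G.PresWins M c)
    (h' : G.ConsWins M' c) : M' < M := by
  obtain ⟨σ, hσ⟩ := h
  obtain ⟨τ, hτ⟩ := h'
  obtain ⟨m, hm⟩ := hτ σ
  have := hσ τ m
  lia

theorem presWins_iff_safe [Finite V] {c : G.Config} {e : ℤ} : G.PresWins e c ↔ G.Safe c e := by
  refine ⟨fun h => ?_, presWins_of_safe⟩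
  by_contra hs
  simp only [Safe, not_forall] at hs
  obtain ⟨n, hn⟩ := hs
  exact (h.lt_of_consWins (consWins_of_not_survives hn)).false

theorem consWins_of_not_safe [Finite V] {c : G.Config} {e : ℤ} (h : ¬ G.Safe c e) :
    G.ConsWins e c := by
  simp only [Safe, not_forall] at h
  obtain ⟨n, hn⟩ := h
  exact consWins_of_not_survives hn

theorem exists_isEnergyThreshold [Finite V] : ∃ en, G.IsEnergyThreshold en := by
  classical
  refine ⟨fun v B => if h : ∃ M : ℕ, G.Safe (v, B) M then (Nat.find h : ℕ∞) else ⊤,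
    fun v B => ⟨fun M hM => ?_, fun htop M => ?_⟩⟩
  · dsimp only at hM
    split_ifs at hM with h
    · obtain rfl : Nat.find h = M := by exact_mod_cast hM
      refine ⟨presWins_of_safe (Nat.find_spec h), consWins_of_not_safe fun hs => ?_⟩
      have h0 := (hs 0).nonneg
      have hlt : (Nat.find h : ℤ) - 1 = ((Nat.find h - 1 : ℕ) : ℤ) := by lia
      rw [hlt] at hs
      exact Nat.find_min h (by lia) hs
    · exact (ENat.natCast_ne_top M hM.symm).elim
  · dsimp only at htop
    split_ifs at htop with h
    · exact (ENat.natCast_ne_top _ htop).elim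
    · exact consWins_of_not_safe fun hs => h ⟨M, hs⟩

theorem IsEnergyThreshold.lt_top_iff {en : V → G.Budget → ℕ∞} (h : G.IsEnergyThreshold en)
    (v : V) (B : G.Budget) : en v B < ⊤ ↔ ∃ M : ℕ, G.PresWins M (v, B) := by
  constructor
  · intro hlt
    obtain ⟨M, hM⟩ := ENat.ne_top_iff_exists.1 hlt.ne
    exact ⟨M, ((h v B).1 M hM.symm).1⟩
  · rintro ⟨M, hM⟩
    refine lt_top_iff_ne_top.2 fun htop => ?_
    exact (hM.lt_of_consWins ((h v B).2 htop M)).false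

/-- The right-hand side does not mention `en`, which yields uniqueness. -/
theorem IsEnergyThreshold.le_iff {en : V → G.Budget → ℕ∞} (h : G.IsEnergyThreshold en)
    (v : V) (B : G.Budget) (M : ℕ) : en v B ≤ M ↔ ∃ M' : ℕ, M' ≤ M ∧ G.PresWins M' (v, B) := by
  constructor
  · intro hle
    obtain ⟨M', hM'⟩ := ENat.ne_top_iff_exists.1 (hle.trans_lt (ENat.natCast_lt_top M)).ne
    rw [← hM'] at hle
    exact ⟨M', by exact_mod_cast hle, ((h v B).1 M' hM'.symm).1⟩
  · rintro ⟨M', hle, hM'⟩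
    obtain ⟨N, hN⟩ := ENat.ne_top_iff_exists.1 ((h.lt_top_iff v B).2 ⟨M', hM'⟩).ne
    have := hM'.lt_of_consWins ((h v B).1 N hN.symm).2
    rw [← hN]
    exact_mod_cast (by lia : N ≤ M)

theorem IsEnergyThreshold.unique {en en' : V → G.Budget → ℕ∞} (h : G.IsEnergyThreshold en)
    (h' : G.IsEnergyThreshold en') : en = en' := by
  funext v B
  refine ENat.eq_of_forall_natCast_le_iff fun M => ?_
  cases M with
  | zero => simp
  | succ M =>
    have := (h.le_iff v B M).trans (h'.le_iff v B M).symm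
    rw [← not_iff_not, not_le, not_le] at this
    simpa [ENat.add_one_le_iff] using this

theorem threshold_eq_leastBudget (en : V → G.Budget → ℕ∞) (v : V) :
    (G.threshold en v).1 = G.leastBudget fun B => en v B < ⊤ := by
  by_cases h : (G.finiteBudgets en v).Nonempty
  · refine (congrArg Subtype.val (dif_pos h)).trans ?_
    rw [leastBudget, dif_pos (show {B | ∃ hB : B ≤ ⟨G.k, true⟩, en v ⟨B, hB⟩ < ⊤}.Nonempty from h)]
    rfl
  · refine (congrArg Subtype.val (dif_neg h)).trans ?_
    rw [leastBudget, dif_neg (show ¬ {B | ∃ hB : B ≤ ⟨G.k, true⟩, en v ⟨B, hB⟩ < ⊤}.Nonempty from h)]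

theorem IsEnergyThreshold.averageProperty [Finite V] {en : V → G.Budget → ℕ∞}
    (h : G.IsEnergyThreshold en) : G.AverageProperty (G.threshold en) := by
  have hsafe (v : V) (B : G.Budget) : en v B < ⊤ ↔ ∃ M : ℕ, G.Safe (v, B) M := by
    simp only [h.lt_top_iff, presWins_iff_safe]
  have hmono (u : V) (B B' : G.Budget) (hB : B.1 ≤ B'.1) (hu : en u B < ⊤) : en u B' < ⊤ := by
    rw [hsafe] at hu ⊢
    exact hu.imp fun M hM => hM.mono_budget hB
  intro v vp vm h1 h2 h3 h4
  simp only [threshold_eq_leastBudget] at h2 h4 ⊢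
  change _ = average _ _
  have hiff (B : G.Budget) : G.leastBudget (fun B => en v B < ⊤) ≤ B.1 ↔
      average (G.leastBudget fun B => en vp B < ⊤) (G.leastBudget fun B => en vm B < ⊤) ≤ B.1 := by
    rw [leastBudget_le_iff (hmono v), hsafe, exists_safe_iff]
    have := exists_presAction_iff (P := fun c => en c.1 c.2 < ⊤) hmono (v, B) h1 h2 h3 h4
    simpa only [hsafe] using this
  have hle : average (G.leastBudget fun B => en vp B < ⊤) (G.leastBudget fun B => en vm B < ⊤) ≤
      ⟨G.k + 1, false⟩ := average_le (h4 vp h1) (leastBudget_le _)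
  have hle' := leastBudget_le (G := G) fun B => en v B < ⊤
  -- `hiff` tests only budgets in `[k]`. This suffices, because a `Y` above `k*` is at least `k +
  -- 1`, which bounds `X`.
  have aux {X Y : StarNat} (hX : X ≤ ⟨G.k + 1, false⟩)
      (hXY : ∀ B : G.Budget, Y ≤ B.1 → X ≤ B.1) : X ≤ Y := by
    by_cases hY : Y ≤ ⟨G.k, true⟩
    · exact hXY ⟨Y, hY⟩ le_rfl
    · refine hX.trans ?_
      rw [le_iff_code] at hY ⊢
      simp [code] at hY ⊢
      omega
  exact le_antisymm (aux hle' fun B => (hiff B).2) (aux hle fun B => (hiff B).1)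

end EnergyGame

theorem mainTheorem2 {V : Type*} [Finite V] (G : EnergyGame V) :
    (∃! en : V → G.Budget → ℕ∞, G.IsEnergyThreshold en) ∧
    ∀ en : V → G.Budget → ℕ∞, G.IsEnergyThreshold en →
      G.AverageProperty (G.threshold en) := by
  obtain ⟨en, hen⟩ := EnergyGame.exists_isEnergyThreshold (G := G)
  exact ⟨⟨en, hen, fun _ h => h.unique hen⟩, fun _ h => h.averageProperty⟩
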